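/- Let $(X,\mathcal B,m)$ be a probability space and let $T:X\to X$ be an invertible (bimeasurable), measure preserving, ergodic transformation which is aperiodic, that is: for every $n\ge 1$ and every $E\in\mathcal B$ with $m(E)>0$ there is a measurable $F\subseteq E$ with $m(F\setminus T^{-n}F)>0$ (on a standard probability space this means that $m(\{x: T^n x=x\})=0$ for every $n\ge 1$). Let $\xi$ be a finite measurable partition of $X$ (modulo $m$-null sets), let $A$ be a nonempty finite set, and let $X_1,\dots,X_l$ be i.i.d. random variables with values in $A$. Then there is a measurable function $f:X\to A$ such that the random vectors $(f\circ T^i)_{i=0}^{l-1}$ and $(X_i)_{i=1}^{l}$ have the same distribution, and $(f\circ T^i)_{i=0}^{l-1}$ is independent of (the $\sigma$-algebra generated by) $\xi$. -/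

import Mathlib

open MeasureTheory ProbabilityTheory

/-- A self-map `T` of a measure space is *aperiodic* if no power `T^n`, `n ≥ 1`, acts trivially on
the measurable subsets of a set of positive measure: every measurable `E` of positive measure
contains a measurable `F` with `μ (F \ T⁻ⁿ F) > 0`. If the measurable sets separate points countably
(for instance on a standard Borel space) this says that the set of periodic points is null, see
`isAperiodic_iff_ae_ne`; this formulation is meaningful on an arbitrary measure space. -/
def IsAperiodic {X : Type*} [MeasurableSpace X] (T : X → X) (μ : Measure X) : Prop :=
  ∀ n : ℕ, 1 ≤ n → ∀ E : Set X, MeasurableSet E → 0 < μ E →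
    ∃ F : Set X, F ⊆ E ∧ MeasurableSet F ∧ 0 < μ (F \ (T^[n]) ⁻¹' F)

/-- On a countably separated space, aperiodicity means that almost no point is periodic. -/
theorem isAperiodic_iff_ae_ne {X : Type*} [MeasurableSpace X]
    [MeasurableSpace.CountablySeparated X] {T : X → X} (hT : Measurable T) (μ : Measure X) :
    IsAperiodic T μ ↔ ∀ n : ℕ, 1 ≤ n → ∀ᵐ x ∂μ, T^[n] x ≠ x := by
  obtain ⟨S, hSc, hSm, hS⟩ :=
    (MeasurableSpace.CountablySeparated.countably_separated (α := X)).exists_countable_separating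
  -- `D n s`: the points of `s` that leave `s` in time `n`, and the same for the complement
  have key : ∀ n : ℕ, {x | T^[n] x ≠ x} =
      ⋃ s ∈ S, ((s \ (T^[n]) ⁻¹' s) ∪ (sᶜ \ (T^[n]) ⁻¹' sᶜ)) := by
    intro n
    ext x
    simp only [Set.mem_ofPred_eq, Set.mem_iUnion, Set.mem_union, Set.mem_sdiff, Set.mem_preimage,
      Set.mem_compl_iff, not_not, exists_prop]
    constructor
    · intro h
      by_contra! hcon
      refine h (hS (T^[n] x) (Set.mem_univ _) x (Set.mem_univ _) fun s hs => ?_)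
      have := hcon s hs
      tauto
    · rintro ⟨s, -, h⟩ heq
      rw [heq] at h
      tauto
  have hTn : ∀ n : ℕ, Measurable (T^[n]) := fun n => hT.iterate n
  constructor
  · intro h n hn
    have hm : MeasurableSet {x | T^[n] x ≠ x} := by
      rw [key n]
      refine MeasurableSet.biUnion hSc fun s hs => ?_
      exact ((hSm s hs).diff (hTn n (hSm s hs))).union
        ((hSm s hs).compl.diff (hTn n (hSm s hs).compl))
    rw [ae_iff]
    by_contra h0
    have hm' : MeasurableSet {x | ¬ T^[n] x ≠ x} := hm.compl
    obtain ⟨F, hF, -, hpos⟩ := h n hn _ hm' (pos_iff_ne_zero.mpr h0)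
    refine hpos.ne' ?_
    have : F \ (T^[n]) ⁻¹' F = ∅ := by
      rw [Set.sdiff_eq_empty]
      intro x hx
      have h1 : T^[n] x = x := not_not.mp (hF hx)
      simpa [h1] using hx
    rw [this, measure_empty]
  · intro h n hn E hE hpos
    by_contra! hcon
    refine hpos.ne' ?_
    have hz : ∀ s : Set X, MeasurableSet s → μ (E ∩ (s \ (T^[n]) ⁻¹' s)) = 0 := by
      intro s hs
      have h1 := hcon (E ∩ s) Set.inter_subset_left (hE.inter hs)
      refine measure_mono_null ?_ (le_antisymm h1 zero_le)
      rintro x ⟨hxE, hxs, hxn⟩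
      exact ⟨⟨hxE, hxs⟩, fun hx => hxn hx.2⟩
    have hz' : μ (E ∩ {x | T^[n] x ≠ x}) = 0 := by
      rw [key n, Set.inter_iUnion₂, measure_biUnion_null_iff hSc]
      intro s hs
      rw [Set.inter_union_distrib_left]
      exact measure_union_null (hz s (hSm s hs)) (hz _ (hSm s hs).compl)
    refine measure_mono_null (fun x hx => ?_) (measure_union_null hz' (ae_iff.mp (h n hn)))
    by_cases hxn : T^[n] x ≠ x
    · exact Or.inl ⟨hx, hxn⟩
    · exact Or.inr hxn

/-! The law is made exact by a perturbation argument in a finite-dimensional space. Let `τ` be the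
target joint law of the block and `J`, and consider the errors `blockLaw μ T l J f - τ` over all
measurable `f`. Finitely many `f` already span the space of all errors. Colour `X` by a
finite-valued function that determines these `f` and takes distinct values along orbit segments of
length `l`; a bounded clock counting the time since a marker set provides the second property.
Substituting i.i.d. letters for colours gives `τ` exactly on average (`sum_weight_smul_blockLaw`).
Hence `0` is a combination with positive weights of errors that span all errors, and it remains a
convex combination after any small perturbation inside that span
(`exists_convex_combination_eq_zero_of_near`).

The perturbation writes a constant letter on the bottom `l` levels of the long columns of a second
clock, which moves each law by `O(l² / N)`. The resulting convex combination is realized by one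
function (`exists_blockLaw_eq_sum`): the substitution is chosen column by column, independently of
all candidate blocks and of `J`. A block entering the next column reads only the constant letter
there, so it never sees a second choice and the mixture has no error. Such choices exist because
aperiodicity excludes atoms. Keeping `J` in the law throughout yields the independence. -/

/-! ### Convexity: stability of a positive relation under perturbation -/

/-- If `0` is a positive combination of the vectors `x i`, then `0` lies in the convex hull of any
sufficiently close family of vectors in the span of the `x i`. -/
theorem exists_convex_combination_eq_zero_of_near {E I : Type*} [NormedAddCommGroup E]
    [InnerProductSpace ℝ E] [FiniteDimensional ℝ E] [Fintype I] [Nonempty I] (x : I → E)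
    (p : I → ℝ) (hp : ∀ i, 0 < p i) (h0 : ∑ i, p i • x i = 0) :
    ∃ ε > 0, ∀ y : I → E, (∀ i, y i ∈ Submodule.span ℝ (Set.range x)) →
      (∀ i, ‖y i - x i‖ < ε) →
      ∃ θ : I → ℝ, (∀ i, 0 ≤ θ i) ∧ ∑ i, θ i = 1 ∧ ∑ i, θ i • y i = 0 := by
  classical
  set V := Submodule.span ℝ (Set.range x)
  let K : Set E := Metric.sphere 0 1 ∩ V
  have hK : IsCompact K :=
    (isCompact_sphere 0 1).inter_right (Submodule.closed_of_finiteDimensional V)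
  let F : E → ℝ := fun u => Finset.univ.sup' Finset.univ_nonempty fun i => inner ℝ u (x i)
  have hF : ContinuousOn F K := by
    refine Continuous.continuousOn ?_
    exact Continuous.finset_sup'_apply _ fun i _ => by fun_prop
  -- The weighted average of the `inner ℝ u (x i)` is `0`; if none were positive, all would vanish
  -- and `u` would be orthogonal to the span containing it.
  have hpos : ∀ u ∈ K, 0 < F u := by
    rintro u ⟨hu1, huV⟩
    by_contra hcon
    have hle : ∀ i, inner ℝ u (x i) ≤ 0 := fun i =>
      (Finset.le_sup' (fun i => inner ℝ u (x i)) (Finset.mem_univ i)).trans (not_lt.mp hcon)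
    have hsum : ∑ i, p i * inner ℝ u (x i) = 0 := by
      have := congrArg (fun z => inner ℝ u z) h0
      simpa [inner_sum, inner_smul_right] using this
    have hz : ∀ i, inner ℝ u (x i) = 0 := by
      intro i
      have := (Finset.sum_eq_zero_iff_of_nonpos
        (fun i _ => mul_nonpos_of_nonneg_of_nonpos (hp i).le (hle i))).1 hsum i (Finset.mem_univ i)
      exact (mul_eq_zero.1 this).resolve_left (hp i).ne'
    have huu : inner ℝ u u = 0 := by
      have hV : V ≤ LinearMap.ker (innerₛₗ ℝ u) := by
        refine Submodule.span_le.2 ?_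
        rintro _ ⟨i, rfl⟩
        simpa using hz i
      simpa using hV huV
    rw [inner_self_eq_zero] at huu
    simp [huu] at hu1
  obtain ⟨δ, hδ, hδF⟩ := hK.exists_forall_le' hF hpos
  refine ⟨δ, hδ, fun y hyV hy => ?_⟩
  let H : Set E := convexHull ℝ (Set.range y)
  have hHV : H ⊆ V := convexHull_min (by rintro _ ⟨i, rfl⟩; exact hyV i) V.convex
  suffices h : (0 : E) ∈ H by
    have hsub : H ⊆ {z | ∃ θ : I → ℝ, (∀ i, 0 ≤ θ i) ∧ ∑ i, θ i = 1 ∧ ∑ i, θ i • y i = z} := by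
      refine convexHull_min ?_ ?_
      · rintro _ ⟨i, rfl⟩
        refine ⟨Pi.single i 1, fun j => ?_, by simp, by simp [Pi.single_apply, ite_smul]⟩
        by_cases hj : j = i <;> simp [hj]
      · rintro _ ⟨θ, h1, h2, rfl⟩ _ ⟨θ', h1', h2', rfl⟩ a b ha hb hab
        refine ⟨fun i => a * θ i + b * θ' i, fun i => ?_, ?_, ?_⟩
        · have := h1 i
          have := h1' i
          positivity
        · rw [Finset.sum_add_distrib, ← Finset.mul_sum, ← Finset.mul_sum, h2, h2']
          linarith
        · simp [add_smul, Finset.sum_add_distrib, Finset.smul_sum, mul_smul]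
    exact hsub h
  have hHc : IsCompact H := (Set.finite_range y).isCompact_convexHull ℝ
  have hHn : H.Nonempty := (Set.range_nonempty y).convexHull
  -- If `0` is not in the hull, the direction `u` from its nearest point `v` towards `0` has
  -- nonpositive inner product with every `y i`, while some `x i` has inner product at least `δ`
  -- with it.
  obtain ⟨v, hv, hvmin⟩ := exists_norm_eq_iInf_of_complete_convex hHn hHc.isComplete
    (convex_convexHull ℝ _) 0
  have hin := (norm_eq_iInf_iff_real_inner_le_zero (convex_convexHull ℝ _) hv).1 hvmin
  by_contra h0H
  have hv0 : v ≠ 0 := fun h => h0H (h ▸ hv)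
  have hvn : 0 < ‖v‖ := norm_pos_iff.2 hv0
  let u : E := -(‖v‖⁻¹ • v)
  have hun : ‖u‖ = 1 := by
    simp only [u, norm_neg, norm_smul, norm_inv, norm_norm]
    exact inv_mul_cancel₀ hvn.ne'
  have huK : u ∈ K := ⟨by simpa using hun, V.neg_mem (V.smul_mem _ (hHV hv))⟩
  obtain ⟨i, -, hi⟩ := Finset.exists_mem_eq_sup' Finset.univ_nonempty
    (fun i => inner ℝ u (x i))
  have hi' : δ ≤ inner ℝ u (x i) := (hδF u huK).trans hi.le
  have h1 : 0 < inner ℝ u (y i) := by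
    have h2 : inner ℝ u (x i - y i) < δ := by
      calc inner ℝ u (x i - y i) ≤ ‖u‖ * ‖x i - y i‖ := real_inner_le_norm _ _
        _ = ‖y i - x i‖ := by rw [hun, one_mul, norm_sub_rev]
        _ < δ := hy i
    rw [inner_sub_right] at h2
    linarith
  have h3 := hin (y i) (subset_convexHull ℝ _ ⟨i, rfl⟩)
  have h4 : inner ℝ v v ≤ inner ℝ v (y i) := by
    simpa [inner_sub_right] using h3
  have h5 : 0 ≤ inner ℝ v (y i) := real_inner_self_nonneg.trans h4
  have h6 : inner ℝ u (y i) = -(‖v‖⁻¹ * inner ℝ v (y i)) := by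
    simp [u, inner_neg_left, real_inner_smul_left]
  have h7 : 0 ≤ ‖v‖⁻¹ * inner ℝ v (y i) := by positivity
  linarith

/-! ### Nonatomic measures: prescribed measures and independent choices -/

/-- Sierpiński: if every set of positive measure has measurable subsets of arbitrarily small
positive measure, then measurable subsets take all intermediate measures. -/
theorem exists_subset_measureReal_eq {X : Type*} [MeasurableSpace X] {μ : Measure X}
    [IsFiniteMeasure μ]
    (H : ∀ E, MeasurableSet E → 0 < μ.real E → ∀ ε > 0,
      ∃ F ⊆ E, MeasurableSet F ∧ 0 < μ.real F ∧ μ.real F < ε)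
    {E : Set X} (hE : MeasurableSet E) {t : ℝ} (ht0 : 0 ≤ t) (htE : t ≤ μ.real E) :
    ∃ F ⊆ E, MeasurableSet F ∧ μ.real F = t := by
  let Q : Type _ := {F : Set X // F ⊆ E ∧ MeasurableSet F ∧ μ.real F ≤ t}
  -- Greedy exhaustion: each stage is within `1 / (n + 1)` of the best admissible extension. If the
  -- union fell short of `t`, a fixed small set could be added at every stage, contradicting this in
  -- the limit.
  have step : ∀ (n : ℕ) (F : Q), ∃ G : Q, F.1 ⊆ G.1 ∧
      ∀ G' : Q, F.1 ⊆ G'.1 → μ.real G'.1 ≤ μ.real G.1 + 1 / ((n : ℝ) + 1) := by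
    intro n F
    let R : Set ℝ := (fun G : Q => μ.real G.1) '' {G | F.1 ⊆ G.1}
    have hRne : R.Nonempty := ⟨_, F, Set.Subset.rfl, rfl⟩
    have hRb : BddAbove R := ⟨t, by rintro _ ⟨G, -, rfl⟩; exact G.2.2.2⟩
    obtain ⟨_, ⟨G, hG, rfl⟩, hlt⟩ := exists_lt_of_lt_csSup hRne
      (sub_lt_self (sSup R) (by positivity : (0 : ℝ) < 1 / ((n : ℝ) + 1)))
    refine ⟨G, hG, fun G' hG' => ?_⟩
    have := le_csSup hRb ⟨G', hG', rfl⟩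
    simp only at hlt this
    linarith
  choose nxt hsub hmax using step
  let S : ℕ → Q := fun n => Nat.rec ⟨∅, by simp, by simp, by simpa using ht0⟩ nxt n
  have hS : ∀ n, S (n + 1) = nxt n (S n) := fun n => rfl
  have hmono : Monotone fun n => (S n).1 :=
    monotone_nat_of_le_succ fun n => by rw [hS]; exact hsub n _
  let F : Set X := ⋃ n, (S n).1
  have hFE : F ⊆ E := Set.iUnion_subset fun n => (S n).2.1
  have hFm : MeasurableSet F := MeasurableSet.iUnion fun n => (S n).2.2.1
  have hlim : Filter.Tendsto (fun n => μ.real (S n).1) Filter.atTop (nhds (μ.real F)) := by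
    have := tendsto_measure_iUnion_atTop (μ := μ) hmono
    exact (ENNReal.tendsto_toReal (measure_ne_top μ _)).comp this
  have hFt : μ.real F ≤ t := le_of_tendsto' hlim fun n => (S n).2.2.2
  refine ⟨F, hFE, hFm, hFt.antisymm ?_⟩
  by_contra! hlt
  have hpos : 0 < μ.real (E \ F) := by
    rw [measureReal_sdiff hFE hFm]; linarith
  obtain ⟨G, hGE, hGm, hG0, hGt⟩ := H (E \ F) (hE.diff hFm) hpos (t - μ.real F) (by linarith)
  have hdis : Disjoint F G := Set.disjoint_left.2 fun x hx hxG => (hGE hxG).2 hx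
  have hU : μ.real (F ∪ G) = μ.real F + μ.real G := measureReal_union hdis hGm
  let G' : Q := ⟨F ∪ G, Set.union_subset hFE (hGE.trans Set.sdiff_subset), hFm.union hGm, by
    rw [hU]; linarith⟩
  have hb : ∀ n : ℕ, μ.real F + μ.real G ≤ μ.real (S (n + 1)).1 + 1 / ((n : ℝ) + 1) := by
    intro n
    rw [← hU, hS]
    exact hmax n (S n) G' ((Set.subset_iUnion (fun n => (S n).1) n).trans Set.subset_union_left)
  have hl2 := (hlim.comp (Filter.tendsto_add_atTop_nat 1)).add tendsto_one_div_add_atTop_nhds_zero_nat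
  have := ge_of_tendsto' hl2 hb
  linarith

/-- A set can be split into pieces of prescribed measures. -/
theorem exists_measurable_split {X : Type*} [MeasurableSpace X] {μ : Measure X}
    [IsFiniteMeasure μ]
    (H : ∀ E, MeasurableSet E → ∀ t, 0 ≤ t → t ≤ μ.real E →
      ∃ F ⊆ E, MeasurableSet F ∧ μ.real F = t)
    {I : Type*} [MeasurableSpace I] {s : Finset I} (hs : s.Nonempty) :
    ∀ (E : Set X) (t : I → ℝ), MeasurableSet E → (∀ i ∈ s, 0 ≤ t i) → ∑ i ∈ s, t i = μ.real E →
      ∃ κ : X → I, Measurable κ ∧ (∀ x, κ x ∈ s) ∧ ∀ i ∈ s, μ.real (κ ⁻¹' {i} ∩ E) = t i := by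
  classical
  induction hs using Finset.Nonempty.cons_induction with
  | singleton a =>
    intro E t hE _ ht
    refine ⟨fun _ => a, measurable_const, by simp, ?_⟩
    intro i hi
    rw [Finset.mem_singleton] at hi
    subst hi
    simpa using ht.symm
  | cons a s ha hs ih =>
    intro E t hE h0 ht
    rw [Finset.sum_cons] at ht
    have hs0 : ∀ i ∈ s, 0 ≤ t i := fun i hi => h0 i (Finset.mem_cons_of_mem hi)
    obtain ⟨F, hFE, hFm, hF⟩ := H E hE (t a) (h0 a (Finset.mem_cons_self a s))
      (by linarith [Finset.sum_nonneg hs0])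
    obtain ⟨κ, hκm, hκs, hκ⟩ := ih (E \ F) t (hE.diff hFm) hs0
      (by rw [measureReal_sdiff hFE hFm]; linarith)
    refine ⟨fun x => if x ∈ F then a else κ x, Measurable.ite hFm measurable_const hκm, ?_, ?_⟩
    · intro x
      by_cases hx : x ∈ F <;> simp [hx, hκs]
    · intro i hi
      rcases Finset.mem_cons.1 hi with rfl | hi
      · rw [← hF]
        congr 1
        ext x
        have : κ x ≠ i := fun h => ha (h ▸ hκs x)
        by_cases hx : x ∈ F
        · simp [hx, hFE hx]
        · simp [hx, this]
      · rw [← hκ i hi]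
        have : a ≠ i := fun h => ha (h ▸ hi)
        congr 1
        ext x
        by_cases hx : x ∈ F <;> simp [hx, this]

/-- A random choice with given law that is independent of a given finite-valued function. -/
theorem exists_measurable_indep_choice {X : Type*} [MeasurableSpace X] {μ : Measure X}
    [IsFiniteMeasure μ]
    (H : ∀ E, MeasurableSet E → ∀ t, 0 ≤ t → t ≤ μ.real E →
      ∃ F ⊆ E, MeasurableSet F ∧ μ.real F = t)
    {I : Type*} [Fintype I] [MeasurableSpace I] [DiscreteMeasurableSpace I]
    {C : Type*} [Finite C] [MeasurableSpace C] [DiscreteMeasurableSpace C]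
    (θ : I → ℝ) (hθ0 : ∀ i, 0 ≤ θ i) (hθ : ∑ i, θ i = 1) {c : X → C} (hc : Measurable c) :
    ∃ κ : X → I, Measurable κ ∧
      ∀ i (s : Set C), μ.real (κ ⁻¹' {i} ∩ c ⁻¹' s) = θ i * μ.real (c ⁻¹' s) := by
  classical
  have := Fintype.ofFinite C
  have hI : (Finset.univ : Finset I).Nonempty := by
    by_contra h
    simp [Finset.not_nonempty_iff_eq_empty.1 h] at hθ
  have hcm : ∀ s : Set C, MeasurableSet (c ⁻¹' s) := fun s => hc (MeasurableSet.of_discrete)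
  -- Splitting each fibre of `c` in the proportions `θ` and gluing gives the independence.
  have : ∀ e : C, ∃ κ : X → I, Measurable κ ∧
      ∀ i, μ.real (κ ⁻¹' {i} ∩ c ⁻¹' {e}) = θ i * μ.real (c ⁻¹' {e}) := by
    intro e
    obtain ⟨κ, h1, -, h2⟩ := exists_measurable_split H hI (c ⁻¹' {e})
      (fun i => θ i * μ.real (c ⁻¹' {e})) (hcm _)
      (fun i _ => mul_nonneg (hθ0 i) measureReal_nonneg) (by rw [← Finset.sum_mul, hθ, one_mul])
    exact ⟨κ, h1, fun i => h2 i (Finset.mem_univ i)⟩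
  choose κ hκm hκ using this
  have hm : Measurable fun x => κ (c x) x := by
    have : Measurable fun z : C × X => κ z.1 z.2 := measurable_from_prod_countable_right hκm
    exact this.comp (hc.prodMk measurable_id)
  refine ⟨fun x => κ (c x) x, hm, fun i s => ?_⟩
  have key : ∀ G : Set X, MeasurableSet G →
      μ.real (G ∩ c ⁻¹' s) = ∑ e ∈ s.toFinset, μ.real (G ∩ c ⁻¹' {e}) := by
    intro G hG
    rw [← measureReal_biUnion_finset]
    · congr 1
      ext x
      simp
    · intro e _ e' _ hne
      refine Set.disjoint_left.2 ?_
      rintro x ⟨-, h1⟩ ⟨-, h2⟩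
      exact hne (h1.symm.trans h2)
    · exact fun e _ => hG.inter (hcm _)
  have key' := key Set.univ MeasurableSet.univ
  simp only [Set.univ_inter] at key'
  rw [key _ (hm (MeasurableSet.of_discrete)), key', Finset.mul_sum]
  refine Finset.sum_congr rfl fun e _ => ?_
  rw [← hκ e i]
  congr 1
  ext x
  simp only [Set.mem_inter_iff, Set.mem_preimage, Set.mem_singleton_iff]
  constructor <;> rintro ⟨h1, rfl⟩ <;> exact ⟨h1, rfl⟩

/-! ### Marker sets and clocks -/

section Markers

variable {X : Type*} [MeasurableSpace X] {μ : Measure X} {T : X ≃ᵐ X}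

/-- Passing to `G \ T⁻ᴺ G` removes returns at time `N`, and smaller times stay excluded in any
subset. -/
theorem IsAperiodic.exists_subset_no_return (hT : IsAperiodic T μ) (N : ℕ) {E : Set X}
    (hE : MeasurableSet E) (hpos : 0 < μ E) :
    ∃ F ⊆ E, MeasurableSet F ∧ 0 < μ F ∧ ∀ n, 1 ≤ n → n < N → ∀ x ∈ F, T^[n] x ∉ F := by
  induction N with
  | zero => exact ⟨E, subset_rfl, hE, hpos, fun n _ h => absurd h (by omega)⟩
  | succ N ih =>
    obtain ⟨F, hFE, hF, hF0, hFr⟩ := ih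
    rcases Nat.eq_zero_or_pos N with rfl | hN
    · exact ⟨F, hFE, hF, hF0, fun n _ h => absurd h (by omega)⟩
    obtain ⟨G, hGF, hG, hG0⟩ := hT N hN F hF hF0
    refine ⟨G \ T^[N] ⁻¹' G, Set.sdiff_subset.trans (hGF.trans hFE),
      hG.diff ((T.measurable.iterate N) hG), hG0, fun n h1 hn x hx hxn => ?_⟩
    rcases Nat.lt_succ_iff_lt_or_eq.1 hn with h | rfl
    · exact hFr n h1 h x (hGF hx.1) (hGF hxn.1)
    · exact hx.2 hxn.1

/-- The position of a clock after `n` steps, for `n` at most its minimal running time. -/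
theorem ae_clock_iterate {N : ℕ} {h : X → ℕ} (hT : MeasurePreserving T μ μ)
    (hh : ∀ᵐ x ∂μ, h (T x) = h x + 1 ∨ (h (T x) = 0 ∧ N ≤ h x + 1)) :
    ∀ᵐ x ∂μ, ∀ m n, n < N → h (T^[m + n] x) = h (T^[m] x) + n ∨
      (h (T^[m + n] x) < n ∧ N + h (T^[m + n] x) ≤ h (T^[m] x) + n) := by
  have : ∀ᵐ x ∂μ, ∀ n, h (T (T^[n] x)) = h (T^[n] x) + 1 ∨
      (h (T (T^[n] x)) = 0 ∧ N ≤ h (T^[n] x) + 1) :=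
    ae_all_iff.2 fun n => (hT.iterate n).quasiMeasurePreserving.ae hh
  filter_upwards [this] with x hx m n
  induction n with
  | zero => intro _; left; rfl
  | succ n ih =>
    intro hn
    have h1 := ih (by omega)
    have h2 := hx (m + n)
    rw [← Function.iterate_succ_apply' T, Nat.succ_eq_add_one] at h2
    change h (T^[m + n + 1] x) = _ ∨ (h (T^[m + n + 1] x) < _ ∧ N + h (T^[m + n + 1] x) ≤ _)
    -- After one reset the clock reads less than `n`, so it cannot be reset again before time `N`.
    omega

/-- Between two times less than `N` apart the clock either has not been reset and has increased, or
has been reset once and is strictly below its earlier value. -/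
theorem ae_clock_injective {N : ℕ} {h : X → ℕ} (hT : MeasurePreserving T μ μ)
    (hh : ∀ᵐ x ∂μ, h (T x) = h x + 1 ∨ (h (T x) = 0 ∧ N ≤ h x + 1)) {l : ℕ} (hl : l ≤ N) :
    ∀ᵐ x ∂μ, Function.Injective fun i : Fin l => h (T^[i] x) := by
  filter_upwards [ae_clock_iterate hT hh] with x hx
  have aux : ∀ i j : Fin l, i < j → h (T^[i] x) ≠ h (T^[j] x) := by
    intro i j hij heq
    have hij' : (i : ℕ) < j := hij
    have hj := j.2
    have := hx i (j - i) (by omega)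
    rw [Nat.add_sub_cancel' hij'.le] at this
    omega
  intro i j hij
  rcases lt_trichotomy i j with h1 | h1 | h1
  · exact absurd hij (aux i j h1)
  · exact h1
  · exact absurd hij.symm (aux j i h1)

variable [IsProbabilityMeasure μ]

theorem measureReal_le_of_no_return (hT : MeasurePreserving T μ μ) {N : ℕ} {F : Set X}
    (hF : MeasurableSet F) (hFr : ∀ n, 1 ≤ n → n < N → ∀ x ∈ F, T^[n] x ∉ F) :
    N * μ.real F ≤ 1 := by
  have h1 : ∑ i ∈ Finset.range N, μ.real (T^[i] ⁻¹' F) ≤ 1 := by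
    rw [← measureReal_biUnion_finset]
    · exact measureReal_le_one
    · have aux : ∀ i j, i < j → j < N → Disjoint (T^[i] ⁻¹' F) (T^[j] ⁻¹' F) := by
        intro i j hij hj
        refine Set.disjoint_left.2 fun x hx hx' => ?_
        refine hFr (j - i) (by omega) (by omega) _ hx ?_
        rw [← Function.iterate_add_apply, Nat.sub_add_cancel hij.le]
        exact hx'
      intro i hi j hj hij
      simp only [Finset.coe_range, Set.mem_Iio] at hi hj
      rcases lt_or_gt_of_ne hij with h | h
      · exact aux i j h hj
      · exact (aux j i h hi).symm
    · exact fun i _ => (T.measurable.iterate i) hF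
  have h2 : ∀ i ∈ Finset.range N, μ.real (T^[i] ⁻¹' F) = μ.real F := fun i _ =>
    (hT.iterate i).measureReal_preimage hF.nullMeasurableSet
  rw [Finset.sum_congr rfl h2] at h1
  simpa using h1

/-- A set without returns before time `N` has `N` disjoint preimages of equal measure, so its
measure is at most `1 / N`. This is where aperiodicity excludes atoms. -/
theorem IsAperiodic.exists_subset_measureReal_lt (hap : IsAperiodic T μ)
    (hT : MeasurePreserving T μ μ) {E : Set X} (hE : MeasurableSet E) (hpos : 0 < μ.real E)
    {ε : ℝ} (hε : 0 < ε) :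
    ∃ F ⊆ E, MeasurableSet F ∧ 0 < μ.real F ∧ μ.real F < ε := by
  obtain ⟨N, hN⟩ := exists_nat_gt (1 / ε)
  obtain ⟨F, hFE, hF, hF0, hFr⟩ := hap.exists_subset_no_return N hE
    ((ENNReal.toReal_pos_iff.1 hpos).1)
  have h1 := measureReal_le_of_no_return hT hF hFr
  have hF0' : 0 < μ.real F := ENNReal.toReal_pos hF0.ne' (measure_ne_top μ F)
  refine ⟨F, hFE, hF, hF0', ?_⟩
  rw [div_lt_iff₀ hε] at hN
  by_contra! hcon
  nlinarith [Nat.cast_nonneg (α := ℝ) N]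

theorem Ergodic.ae_exists_iterate_mem (hT : Ergodic T μ) {E : Set X} (hE : MeasurableSet E)
    (hpos : 0 < μ E) : ∀ᵐ x ∂μ, ∃ n, T^[n] x ∈ E := by
  let U : Set X := ⋃ n, T^[n] ⁻¹' E
  have hU : MeasurableSet U := MeasurableSet.iUnion fun n => (T.measurable.iterate n) hE
  have hsub : T ⁻¹' U ⊆ U := by
    intro x hx
    obtain ⟨n, hn⟩ := Set.mem_iUnion.1 hx
    exact Set.mem_iUnion.2 ⟨n + 1, hn⟩
  rcases hT.ae_empty_or_univ_of_preimage_ae_le hU.nullMeasurableSet hsub.eventuallyLE with h | h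
  · have h0 : μ U = 0 := by rw [measure_congr h, measure_empty]
    exact absurd (measure_mono_null (Set.subset_iUnion (fun n => T^[n] ⁻¹' E) 0) h0) hpos.ne'
  · filter_upwards [h.mem_iff] with x hx
    exact Set.mem_iUnion.1 (hx.2 trivial)

/-- A marker set: its visits along an orbit are at least `N` apart and almost every orbit segment
of length `2 * N - 1` contains one. -/
theorem exists_marker_set (hT : Ergodic T μ) (hap : IsAperiodic T μ) (N : ℕ) :
    ∃ B : Set X, MeasurableSet B ∧ (∀ n, 1 ≤ n → n < N → ∀ x ∈ B, T^[n] x ∉ B) ∧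
      ∀ᵐ x ∂μ, (0 < N → ∃ i < N, T^[i] x ∈ B ∨ T.symm^[i] x ∈ B) := by
  obtain ⟨E, -, hE, hE0, hEr⟩ := hap.exists_subset_no_return N MeasurableSet.univ (by simp)
  let nbhd : Set X → Set X := fun B => ⋃ i ∈ Finset.range N, (T^[i] ⁻¹' B ∪ T.symm^[i] ⁻¹' B)
  have hnbhd : ∀ B, MeasurableSet B → MeasurableSet (nbhd B) := fun B hB =>
    Finset.measurableSet_biUnion _ fun i _ =>
      ((T.measurable.iterate i) hB).union ((T.symm.measurable.iterate i) hB)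
  -- Stage `n` adds the points of `T⁻ⁿ E` at orbit distance at least `N` from the earlier ones. A
  -- point reaching `E` at time `n` is then either added or already near a marker.
  let S : ℕ → Set X := fun n => Nat.rec ∅ (fun n B => B ∪ (T^[n] ⁻¹' E \ nbhd B)) n
  have hS : ∀ n, S (n + 1) = S n ∪ (T^[n] ⁻¹' E \ nbhd (S n)) := fun n => rfl
  have hmono : Monotone S := monotone_nat_of_le_succ fun n => by
    rw [hS]; exact Set.subset_union_left
  have hmeas : ∀ n, MeasurableSet (S n) := by
    intro n
    induction n with
    | zero => exact MeasurableSet.empty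
    | succ n ih => rw [hS]; exact ih.union (((T.measurable.iterate n) hE).diff (hnbhd _ ih))
  have hsep : ∀ k, ∀ n, 1 ≤ n → n < N → ∀ x ∈ S k, T^[n] x ∉ S k := by
    intro k
    induction k with
    | zero => intro n _ _ x hx; exact absurd hx (Set.notMem_empty x)
    | succ k ih =>
      intro n h1 hn x hx hx'
      rw [hS] at hx hx'
      rcases hx with hx | ⟨hx, hxn⟩ <;> rcases hx' with hx' | ⟨hx', hxn'⟩
      · exact ih n h1 hn x hx hx'
      · refine hxn' (Set.mem_biUnion (Finset.mem_coe.2 (Finset.mem_range.2 hn)) (Or.inr ?_))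
        have : Function.LeftInverse T.symm^[n] T^[n] :=
          Function.LeftInverse.iterate T.symm_apply_apply n
        simpa [this x] using hx
      · exact hxn (Set.mem_biUnion (Finset.mem_coe.2 (Finset.mem_range.2 hn)) (Or.inl hx'))
      · refine hEr n h1 hn _ hx ?_
        rw [← Function.iterate_add_apply, Nat.add_comm, Function.iterate_add_apply]
        exact hx'
  refine ⟨⋃ n, S n, MeasurableSet.iUnion hmeas, ?_, ?_⟩
  · intro n h1 hn x hx hx'
    obtain ⟨i, hi⟩ := Set.mem_iUnion.1 hx
    obtain ⟨j, hj⟩ := Set.mem_iUnion.1 hx'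
    exact hsep (max i j) n h1 hn x (hmono (le_max_left i j) hi) (hmono (le_max_right i j) hj)
  · filter_upwards [hT.ae_exists_iterate_mem hE hE0] with x ⟨n, hn⟩ hN
    by_cases hx : x ∈ nbhd (S n)
    · obtain ⟨i, hi, h⟩ := Set.mem_iUnion₂.1 hx
      exact ⟨i, Finset.mem_range.1 hi, h.imp (fun h => Set.mem_iUnion.2 ⟨n, h⟩)
        (fun h => Set.mem_iUnion.2 ⟨n, h⟩)⟩
    · refine ⟨0, hN, Or.inl (Set.mem_iUnion.2 ⟨n + 1, ?_⟩)⟩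
      rw [hS]
      exact Or.inr ⟨hn, hx⟩

/-- A clock that counts the time since the last visit to a marker set; it is bounded, and is reset
only after running for at least `N` steps. -/
theorem exists_clock (hT : Ergodic T μ) (hap : IsAperiodic T μ) {N : ℕ} (hN : 0 < N) :
    ∃ h : X → ℕ, Measurable h ∧ (∀ x, h x < 2 * N) ∧
      ∀ᵐ x ∂μ, h (T x) = h x + 1 ∨ (h (T x) = 0 ∧ N ≤ h x + 1) := by
  classical
  obtain ⟨B, hB, hsep, hcov⟩ := exists_marker_set hT hap N
  -- The alternative `i = 2 * N - 1` makes the search total and the clock bounded everywhere; almost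
  -- surely a marker is found earlier.
  let p : X → ℕ → Prop := fun x i => T.symm^[i] x ∈ B ∨ i = 2 * N - 1
  have hp : ∀ x, ∃ i, p x i := fun x => ⟨2 * N - 1, Or.inr rfl⟩
  have hpm : ∀ i, MeasurableSet {x | p x i} := fun i => by
    by_cases hi : i = 2 * N - 1
    · simp [p, hi]
    · have : {x | p x i} = T.symm^[i] ⁻¹' B := by ext x; simp [p, hi]
      rw [this]
      exact (T.symm.measurable.iterate i) hB
  refine ⟨fun x => Nat.find (hp x), measurable_find hp hpm, fun x => ?_, ?_⟩
  · have : Nat.find (hp x) ≤ 2 * N - 1 := Nat.find_min' (hp x) (Or.inr rfl)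
    exact lt_of_le_of_lt this (by omega)
  · have hcov' : ∀ᵐ x ∂μ, ∃ i < 2 * N - 1, T.symm^[i] x ∈ B := by
      -- Covering is applied at `T⁻⁽ᴺ⁻¹⁾ x`, so that a marker within `N - 1` steps on either side
      -- lies in the past of `x`, at most `2 * N - 2` steps back.
      have hTs := (hT.symm.toMeasurePreserving.iterate (N - 1)).quasiMeasurePreserving.ae hcov
      filter_upwards [hTs] with x hx
      obtain ⟨i, hi, h | h⟩ := hx hN
      · refine ⟨N - 1 - i, by omega, ?_⟩
        have : N - 1 = i + (N - 1 - i) := by omega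
        rw [this, Function.iterate_add_apply] at h
        have hl : Function.LeftInverse T^[i] T.symm^[i] :=
          Function.LeftInverse.iterate T.apply_symm_apply i
        rwa [hl] at h
      · refine ⟨i + (N - 1), by omega, ?_⟩
        rw [Function.iterate_add_apply]
        exact h
    filter_upwards [hcov'] with x ⟨i, hi, hxi⟩
    have hle : Nat.find (hp x) ≤ i := Nat.find_min' (hp x) (Or.inl hxi)
    have hmem : T.symm^[Nat.find (hp x)] x ∈ B :=
      (Nat.find_spec (hp x)).resolve_right (by omega)
    have hstep : ∀ m, T.symm^[m + 1] (T x) = T.symm^[m] x := fun m => by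
      rw [Function.iterate_succ_apply, T.symm_apply_apply]
    by_cases hTx : T x ∈ B
    · refine Or.inr ⟨(Nat.find_eq_zero _).2 (Or.inl hTx), ?_⟩
      by_contra! hlt
      refine hsep _ (by omega) hlt _ hmem ?_
      have hl : Function.LeftInverse T^[Nat.find (hp x)] T.symm^[Nat.find (hp x)] :=
        Function.LeftInverse.iterate T.apply_symm_apply _
      rw [Function.iterate_succ_apply', hl]
      exact hTx
    · refine Or.inl ((Nat.find_eq_iff _).2 ⟨Or.inl ?_, ?_⟩)
      · rw [hstep]; exact hmem
      · rintro (_ | m) hm (h | h)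
        · exact hTx h
        · omega
        · rw [hstep] at h
          exact Nat.find_min (hp x) (Nat.lt_of_succ_lt_succ hm) (Or.inl h)
        · omega

/-- Below `N` the clock reaches `j + 1` only from `j` and always moves on from `j`, so the levels
under `N` have equal measure. -/
theorem measureReal_clock_lt_le {N : ℕ} {h : X → ℕ} (hT : MeasurePreserving T μ μ) (hm : Measurable h)
    (hh : ∀ᵐ x ∂μ, h (T x) = h x + 1 ∨ (h (T x) = 0 ∧ N ≤ h x + 1)) {l : ℕ} (hl : l ≤ N) :
    N * μ.real {x | h x < l} ≤ l := by
  have hms : ∀ j, MeasurableSet (h ⁻¹' {j}) := fun j => hm (measurableSet_singleton j)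
  have heq : ∀ j, j < N → μ.real (h ⁻¹' {j}) = μ.real (h ⁻¹' {0}) := by
    intro j
    induction j with
    | zero => intro _; rfl
    | succ j ih =>
      intro hj
      rw [← ih (by omega), ← hT.measureReal_preimage (hms (j + 1)).nullMeasurableSet]
      refine measureReal_congr ?_
      filter_upwards [hh] with x hx
      refine propext ?_
      change h (T x) = j + 1 ↔ h x = j
      omega
  have hsum : ∀ n, n ≤ N → μ.real {x | h x < n} = n * μ.real (h ⁻¹' {0}) := by
    intro n hn
    have : {x | h x < n} = ⋃ j ∈ Finset.range n, h ⁻¹' {j} := by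
      ext x; simp
    rw [this, measureReal_biUnion_finset _ fun j _ => hms j]
    · rw [Finset.sum_congr rfl fun j hj => heq j ((Finset.mem_range.1 hj).trans_le hn)]
      simp
    · intro i _ j _ hij
      exact Disjoint.preimage h (Set.disjoint_singleton.2 hij)
  have h1 : μ.real {x | h x < N} ≤ 1 := measureReal_le_one
  rw [hsum N le_rfl] at h1
  rw [hsum l hl]
  calc (N : ℝ) * (l * μ.real (h ⁻¹' {0})) = l * (N * μ.real (h ⁻¹' {0})) := by ring
    _ ≤ l * 1 := by gcongr
    _ = l := mul_one _

end Markers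

/-! ### Random substitutions and block laws -/

/-- For independent letters `W k` with law `p`, the letters at distinct sites `u i` are
independent. -/
theorem sum_prod_weight_mul_ite {A K : Type*} [Fintype A] [Fintype K] [DecidableEq A]
    [DecidableEq K] {p : A → ℝ} (hp : ∑ a, p a = 1) {l : ℕ} {u : Fin l → K}
    (hu : Function.Injective u) (w : Fin l → A) :
    ∑ W : K → A, (∏ k, p (W k)) * (if ∀ i, W (u i) = w i then 1 else 0) = ∏ i, p (w i) := by
  -- The constraints are indexed by sites of `K` rather than by `i`, so the sum over `W` factorizes;
  -- sites outside the range of `u` contribute `1`.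
  let q : K → A → ℝ := fun k a => p a * if ∀ i, u i = k → w i = a then 1 else 0
  have h1 : ∀ W : K → A, (∏ k, p (W k)) * (if ∀ i, W (u i) = w i then 1 else 0) =
      ∏ k, q k (W k) := by
    intro W
    rw [Finset.prod_mul_distrib, Finset.prod_boole]
    congr 2
    refine propext ⟨?_, ?_⟩
    · rintro h k - i rfl
      exact (h i).symm
    · intro h i
      exact (h (u i) (Finset.mem_univ _) i rfl).symm
  rw [Finset.sum_congr rfl fun W _ => h1 W, ← Fintype.piFinset_univ, ← Finset.prod_univ_sum]
  refine (Fintype.prod_of_injective u hu _ _ (fun k hk => ?_) (fun i => ?_)).symm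
  · have : ∀ i, u i ≠ k := fun i hi => hk ⟨i, hi⟩
    simp [q, this, hp]
  · have : ∀ a, (∀ j, u j = u i → w j = a) ↔ w i = a := fun a =>
      ⟨fun h => h i rfl, fun h j hj => by rw [hu hj, h]⟩
    simp [q, this]

section BlockLaw

variable {X A C : Type*} [MeasurableSpace X]

/-- The joint law of the `l`-block `(f, f ∘ T, …)` of `f` and of `J`, as a vector. -/
noncomputable def blockLaw (μ : Measure X) (T : X → X) (l : ℕ) (J : X → C) (f : X → A) :
    EuclideanSpace ℝ ((Fin l → A) × C) :=
  WithLp.toLp 2 fun d => μ.real {x | (∀ i : Fin l, f (T^[i] x) = d.1 i) ∧ J x = d.2}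

theorem blockLaw_apply (μ : Measure X) (T : X → X) (l : ℕ) (J : X → C) (f : X → A)
    (d : (Fin l → A) × C) : blockLaw μ T l J f d =
      μ.real {x | (∀ i : Fin l, f (T^[i] x) = d.1 i) ∧ J x = d.2} := rfl

variable [MeasurableSpace A] [DiscreteMeasurableSpace A] [MeasurableSpace C]
  [DiscreteMeasurableSpace C] {μ : Measure X} {l : ℕ} {J : X → C}

theorem measurableSet_block {T : X → X} (hT : Measurable T) (hJ : Measurable J) {f : X → A}
    (hf : Measurable f) (d : (Fin l → A) × C) :
    MeasurableSet {x | (∀ i : Fin l, f (T^[i] x) = d.1 i) ∧ J x = d.2} := by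
  have : {x | (∀ i : Fin l, f (T^[i] x) = d.1 i) ∧ J x = d.2} =
      (⋂ i : Fin l, T^[i] ⁻¹' (f ⁻¹' {d.1 i})) ∩ J ⁻¹' {d.2} := by
    ext x; simp
  rw [this]
  exact (MeasurableSet.iInter fun i : Fin l => (hT.iterate i) (hf (MeasurableSet.of_discrete))).inter
    (hJ (MeasurableSet.of_discrete))

/-- Colour the space so that colours along orbit segments of length `l` are distinct. Substituting
independent random letters for the colours yields, on average, the law of independent letters. -/
theorem sum_weight_smul_blockLaw [Fintype A] [IsProbabilityMeasure μ] {T : X → X} (hT : Measurable T) (hJ : Measurable J)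
    {K : Type*} [Fintype K] [DecidableEq K] [MeasurableSpace K] [DiscreteMeasurableSpace K] {c : X → K}
    (hc : Measurable c) (hinj : ∀ᵐ x ∂μ, Function.Injective fun i : Fin l => c (T^[i] x))
    {p : A → ℝ} (hp : ∑ a, p a = 1) :
    ∑ W : K → A, (∏ k, p (W k)) • blockLaw μ T l J (fun x => W (c x)) =
      WithLp.toLp 2 fun d => (∏ i, p (d.1 i)) * μ.real (J ⁻¹' {d.2}) := by
  classical
  ext d
  have hm : ∀ W : K → A, MeasurableSet {x | (∀ i : Fin l, W (c (T^[i] x)) = d.1 i) ∧ J x = d.2} :=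
    fun W => measurableSet_block hT hJ ((measurable_of_countable W).comp hc) d
  have hJm : MeasurableSet (J ⁻¹' {d.2}) := hJ (MeasurableSet.of_discrete)
  simp only [WithLp.ofLp_sum, WithLp.ofLp_smul, Finset.sum_apply, Pi.smul_apply,
    smul_eq_mul, blockLaw_apply]
  calc ∑ W : K → A, (∏ k, p (W k)) *
        μ.real {x | (∀ i : Fin l, W (c (T^[i] x)) = d.1 i) ∧ J x = d.2}
      = ∑ W : K → A, ∫ x, (∏ k, p (W k)) *
        {x | (∀ i : Fin l, W (c (T^[i] x)) = d.1 i) ∧ J x = d.2}.indicator 1 x ∂μ := by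
        refine Finset.sum_congr rfl fun W _ => ?_
        rw [integral_const_mul, integral_indicator_one (hm W)]
    _ = ∫ x, ∑ W : K → A, (∏ k, p (W k)) *
        {x | (∀ i : Fin l, W (c (T^[i] x)) = d.1 i) ∧ J x = d.2}.indicator 1 x ∂μ := by
        rw [integral_finsetSum]
        intro W _
        exact ((integrable_const (1 : ℝ)).indicator (hm W)).const_mul _
    -- The averaging over `W` is pointwise in `x`, so `J x` is a mere spectator.
    _ = ∫ x, (∏ i, p (d.1 i)) * (J ⁻¹' {d.2}).indicator 1 x ∂μ := by
        refine integral_congr_ae ?_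
        filter_upwards [hinj] with x hx
        by_cases hxJ : J x = d.2
        · have := sum_prod_weight_mul_ite hp hx d.1
          simpa [Set.indicator_apply, hxJ] using this
        · simp [hxJ]
    _ = _ := by rw [integral_const_mul, integral_indicator_one hJm]

end BlockLaw

/-! ### Independent choices on columns -/

section Towers

variable {X : Type*} [MeasurableSpace X] {μ : Measure X} {T : X ≃ᵐ X}

theorem measurable_iterate_clock {h : X → ℕ} (hm : Measurable h) {I : Type*} [MeasurableSpace I]
    {κ : X → I} (hκ : Measurable κ) : Measurable fun x => κ (T.symm^[h x] x) := by
  have : Measurable fun z : ℕ × X => κ (T.symm^[z.1] z.2) :=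
    measurable_from_prod_countable_right fun n => hκ.comp (T.symm.measurable.iterate n)
  exact this.comp (hm.prodMk measurable_id)

/-- A choice made at the bottom of each column of a tower that is independent of a given
finite-valued function on the whole space. -/
theorem exists_column_choice [IsProbabilityMeasure μ] (hT : MeasurePreserving T μ μ)
    (H : ∀ E, MeasurableSet E → ∀ t, 0 ≤ t → t ≤ μ.real E →
      ∃ F ⊆ E, MeasurableSet F ∧ μ.real F = t)
    {h : X → ℕ} (hm : Measurable h) {N : ℕ} (hN : ∀ x, h x < N)
    {I : Type*} [Fintype I] [MeasurableSpace I] [DiscreteMeasurableSpace I]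
    {D : Type*} [Finite D] [MeasurableSpace D] [DiscreteMeasurableSpace D]
    (θ : I → ℝ) (hθ0 : ∀ i, 0 ≤ θ i) (hθ : ∑ i, θ i = 1) {ζ : X → D} (hζ : Measurable ζ) :
    ∃ κ : X → I, Measurable κ ∧ ∀ i (s : Set D),
      μ.real ({x | κ (T.symm^[h x] x) = i} ∩ ζ ⁻¹' s) = θ i * μ.real (ζ ⁻¹' s) := by
  -- The clock and `ζ` along the next `N` points. Moving a point of height `n` back by `T⁻ⁿ` turns
  -- an event on `ζ` into one on `c`, from which `κ` is independent.
  let c : X → (Fin N → Fin N × D) := fun y n => (⟨h (T^[n] y), hN _⟩, ζ (T^[n] y))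
  have hc : Measurable c := by
    refine measurable_pi_lambda _ fun n => ?_
    have h1 : Measurable fun x => (⟨h x, hN x⟩ : Fin N) := by
      refine measurable_to_countable' fun k => ?_
      have : (fun x => (⟨h x, hN x⟩ : Fin N)) ⁻¹' {k} = h ⁻¹' {(k : ℕ)} := by
        ext x; simp [Fin.ext_iff]
      rw [this]
      exact hm (measurableSet_singleton _)
    exact (h1.comp (T.measurable.iterate n)).prodMk (hζ.comp (T.measurable.iterate n))
  obtain ⟨κ, hκm, hκ⟩ := exists_measurable_indep_choice H θ hθ0 hθ hc
  refine ⟨κ, hκm, fun i s => ?_⟩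
  have hkm : MeasurableSet {x | κ (T.symm^[h x] x) = i} :=
    measurable_iterate_clock hm hκm (MeasurableSet.of_discrete (s := {i}))
  have hζm : MeasurableSet (ζ ⁻¹' s) := hζ (MeasurableSet.of_discrete)
  have hsplit : ∀ G : Set X, MeasurableSet G →
      μ.real G = ∑ n : Fin N, μ.real (T^[n] ⁻¹' (G ∩ h ⁻¹' {(n : ℕ)})) := by
    intro G hG
    have hGn : ∀ n : Fin N, MeasurableSet (G ∩ h ⁻¹' {(n : ℕ)}) := fun n =>
      hG.inter (hm (measurableSet_singleton _))
    rw [Finset.sum_congr rfl fun (n : Fin N) _ =>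
      (hT.iterate n).measureReal_preimage (hGn n).nullMeasurableSet]
    rw [← measureReal_biUnion_finset _ fun n _ => hGn n]
    · congr 1
      ext x
      simp only [Finset.mem_univ, Set.iUnion_true, Set.mem_iUnion, Set.mem_inter_iff,
        Set.mem_preimage, Set.mem_singleton_iff]
      exact ⟨fun hx => ⟨⟨h x, hN x⟩, hx, rfl⟩, fun ⟨_, hx, _⟩ => hx⟩
    · intro n _ m _ hnm
      refine Set.disjoint_left.2 ?_
      rintro x ⟨-, h1⟩ ⟨-, h2⟩
      exact hnm (Fin.ext (h1.symm.trans h2))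
  rw [hsplit _ (hkm.inter hζm), hsplit _ hζm, Finset.mul_sum]
  refine Finset.sum_congr rfl fun n _ => ?_
  have h1 : T^[n] ⁻¹' (ζ ⁻¹' s ∩ h ⁻¹' {(n : ℕ)}) = c ⁻¹' {e | (e n).2 ∈ s ∧ (e n).1 = n} := by
    ext y; simp [c, Fin.ext_iff]
  have h2 : T^[n] ⁻¹' ({x | κ (T.symm^[h x] x) = i} ∩ ζ ⁻¹' s ∩ h ⁻¹' {(n : ℕ)}) =
      κ ⁻¹' {i} ∩ c ⁻¹' {e | (e n).2 ∈ s ∧ (e n).1 = n} := by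
    rw [← h1]
    ext y
    have hl : T.symm^[n] (T^[n] y) = y := Function.LeftInverse.iterate T.symm_apply_apply n y
    simp only [Set.mem_preimage, Set.mem_inter_iff, Set.mem_singleton_iff, Set.mem_ofPred_eq]
    constructor
    · rintro ⟨⟨h1, h2⟩, h3⟩
      rw [h3, hl] at h1
      exact ⟨h1, h2, h3⟩
    · rintro ⟨h1, h2, h3⟩
      rw [h3, hl]
      exact ⟨⟨h1, h2⟩, rfl⟩
  rw [h1, h2, hκ]

end Towers

/-! ### Perturbing and mixing block laws -/

theorem EuclideanSpace.norm_le_card_mul {D : Type*} [Fintype D] (z : EuclideanSpace ℝ D) {b : ℝ}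
    (hb : 0 ≤ b) (hz : ∀ d, |z d| ≤ b) : ‖z‖ ≤ Fintype.card D * b := by
  refine abs_le_of_sq_le_sq' ?_ (by positivity) |>.2
  rw [EuclideanSpace.real_norm_sq_eq]
  calc ∑ d, z d ^ 2 ≤ ∑ _d : D, b ^ 2 :=
        Finset.sum_le_sum fun d _ => sq_le_sq' (abs_le.1 (hz d)).1 (abs_le.1 (hz d)).2
    _ = (Fintype.card D : ℝ) * b ^ 2 := by simp
    _ ≤ (Fintype.card D : ℝ) ^ 2 * b ^ 2 := by
        gcongr
        exact_mod_cast Nat.le_self_pow two_ne_zero _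
    _ = _ := by ring

section

variable {X A C : Type*} [MeasurableSpace X] {μ : Measure X} [IsProbabilityMeasure μ]
  {T : X ≃ᵐ X} {l : ℕ} {J : X → C}

/-- The two blocks differ only if one of the `l` iterates falls in `Z`. -/
theorem norm_blockLaw_sub_le [Fintype A] [Fintype C] (hT : MeasurePreserving T μ μ) {f g : X → A} {Z : Set X}
    (hZ : MeasurableSet Z) (hfg : ∀ x ∉ Z, f x = g x) :
    ‖blockLaw μ T l J f - blockLaw μ T l J g‖ ≤
      Fintype.card ((Fin l → A) × C) * (l * μ.real Z) := by
  classical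
  have hU : μ.real (⋃ i : Fin l, T^[i] ⁻¹' Z) ≤ l * μ.real Z := by
    refine (measureReal_iUnion_fintype_le _).trans_eq ?_
    rw [Finset.sum_congr rfl fun (i : Fin l) _ =>
      (hT.iterate i).measureReal_preimage hZ.nullMeasurableSet]
    simp
  have aux : ∀ (f g : X → A), (∀ x ∉ Z, f x = g x) → ∀ d,
      blockLaw μ T l J f d ≤ blockLaw μ T l J g d + l * μ.real Z := by
    intro f g hfg d
    rw [blockLaw_apply, blockLaw_apply]
    refine (measureReal_mono (s₂ := {x | (∀ i : Fin l, g (T^[i] x) = d.1 i) ∧ J x = d.2} ∪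
      ⋃ i : Fin l, T^[i] ⁻¹' Z) ?_).trans
      ((measureReal_union_le _ _).trans (add_le_add le_rfl hU))
    rintro x ⟨hx, hxJ⟩
    by_cases h : x ∈ ⋃ i : Fin l, T^[i] ⁻¹' Z
    · exact Or.inr h
    · refine Or.inl ⟨fun i => ?_, hxJ⟩
      rw [← hx i]
      exact (hfg _ fun hi => h (Set.mem_iUnion.2 ⟨i, hi⟩)).symm
  refine EuclideanSpace.norm_le_card_mul _ (by positivity) fun d => abs_le.2 ?_
  have h1 := aux f g hfg d
  have h2 := aux g f (fun x hx => (hfg x hx).symm) d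
  simp only [PiLp.sub_apply]
  constructor <;> linarith

variable [MeasurableSpace A] [DiscreteMeasurableSpace A] [MeasurableSpace C]
  [DiscreteMeasurableSpace C]

/-- Mixing functions over the columns of a tower, independently of their names, gives exactly the
corresponding mixture of block laws, as long as the functions are constant near the boundary. -/
theorem exists_blockLaw_eq_sum [Finite A] [Finite C] (hT : MeasurePreserving T μ μ)
    (H : ∀ E, MeasurableSet E → ∀ t, 0 ≤ t → t ≤ μ.real E →
      ∃ F ⊆ E, MeasurableSet F ∧ μ.real F = t)
    (hJ : Measurable J) {h : X → ℕ} (hm : Measurable h) {N : ℕ} (hN : ∀ x, h x < 2 * N)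
    (hh : ∀ᵐ x ∂μ, h (T x) = h x + 1 ∨ (h (T x) = 0 ∧ N ≤ h x + 1)) (hl : l ≤ N)
    {I : Type*} [Fintype I] [MeasurableSpace I] [DiscreteMeasurableSpace I]
    (θ : I → ℝ) (hθ0 : ∀ i, 0 ≤ θ i) (hθ : ∑ i, θ i = 1) (a : A) {F : I → X → A}
    (hF : ∀ i, Measurable (F i)) :
    ∃ f : X → A, Measurable f ∧ blockLaw μ T l J f =
      ∑ i, θ i • blockLaw μ T l J (fun x => if h x < l then a else F i x) := by
  classical
  let g : I → X → A := fun i x => if h x < l then a else F i x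
  have hlm : MeasurableSet {x | h x < l} := measurableSet_lt hm measurable_const
  have hg : ∀ i, Measurable (g i) := fun i => Measurable.ite hlm measurable_const (hF i)
  let ζ : X → (I → Fin l → A) × C := fun x => (fun i j => g i (T^[j] x), J x)
  have hζ : Measurable ζ := by
    refine Measurable.prodMk ?_ hJ
    exact measurable_pi_lambda _ fun i => measurable_pi_lambda _ fun j =>
      (hg i).comp (T.measurable.iterate j)
  obtain ⟨κ, hκm, hκ⟩ := exists_column_choice hT H hm hN θ hθ0 hθ hζ
  let k : X → I := fun x => κ (T.symm^[h x] x)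
  have hk : Measurable k := measurable_iterate_clock hm hκm
  let f : X → A := fun x => g (k x) x
  have hfm : Measurable f := by
    have : Measurable fun z : I × X => g z.1 z.2 := measurable_from_prod_countable_right hg
    exact this.comp (hk.prodMk measurable_id)
  refine ⟨f, hfm, ?_⟩
  -- Where the clock is below `l` every candidate is `a`; elsewhere no reset has occurred since `x`,
  -- so the choice is still the one made for `x`.
  have hcol : ∀ᵐ x ∂μ, ∀ i : Fin l, f (T^[i] x) = g (k x) (T^[i] x) := by
    filter_upwards [ae_clock_iterate hT hh] with x hx i
    by_cases hi : h (T^[i] x) < l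
    · simp [f, g, hi]
    · have h1 : h (T^[i] x) = h x + i := by
        have := hx 0 i (by omega)
        rw [Nat.zero_add] at this
        have hil := i.2
        simp only [Function.iterate_zero, id_eq] at this
        omega
      have h2 : k (T^[i] x) = k x := by
        simp only [k]
        rw [h1, Function.iterate_add_apply]
        have hl : T.symm^[i] (T^[i] x) = x :=
          Function.LeftInverse.iterate T.symm_apply_apply i x
        rw [hl]
      simp only [f, h2]
  ext d
  simp only [WithLp.ofLp_sum, WithLp.ofLp_smul, Finset.sum_apply, Pi.smul_apply,
    smul_eq_mul, blockLaw_apply]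
  let s : I → Set ((I → Fin l → A) × C) := fun i => {e | (∀ j, e.1 i j = d.1 j) ∧ e.2 = d.2}
  have h1 : μ.real {x | (∀ i : Fin l, f (T^[i] x) = d.1 i) ∧ J x = d.2} =
      μ.real (⋃ i ∈ (Finset.univ : Finset I), {x | κ (T.symm^[h x] x) = i} ∩ ζ ⁻¹' s i) := by
    refine measureReal_congr ?_
    filter_upwards [hcol] with x hx
    refine propext ?_
    change ((∀ i : Fin l, f (T^[i] x) = d.1 i) ∧ J x = d.2) ↔
      x ∈ ⋃ i ∈ (Finset.univ : Finset I), {x | κ (T.symm^[h x] x) = i} ∩ ζ ⁻¹' s i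
    simp only [hx]
    simp [s, ζ, k]
  rw [h1, measureReal_biUnion_finset]
  · exact Finset.sum_congr rfl fun i _ => hκ i (s i)
  · intro i _ j _ hij
    refine Set.disjoint_left.2 ?_
    rintro x ⟨h1, -⟩ ⟨h2, -⟩
    exact hij (Eq.trans (Eq.symm h1) h2)
  · exact fun i _ => (hk (MeasurableSet.of_discrete (s := {i}))).inter
      (hζ (MeasurableSet.of_discrete))

/-- Independent letters with positive probabilities, independent of `J`, are realized exactly by
the `l`-block of a measurable function. -/
theorem exists_blockLaw_eq [Fintype A] [Fintype C] (hT : Ergodic T μ) (hap : IsAperiodic T μ) (hJ : Measurable J) (l : ℕ)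
    {p : A → ℝ} (hp0 : ∀ a, 0 < p a) (hp : ∑ a, p a = 1) :
    ∃ f : X → A, Measurable f ∧ blockLaw μ T l J f =
      WithLp.toLp 2 fun d => (∏ i, p (d.1 i)) * μ.real (J ⁻¹' {d.2}) := by
  classical
  have hTm := hT.toMeasurePreserving
  have H : ∀ E, MeasurableSet E → ∀ t, 0 ≤ t → t ≤ μ.real E →
      ∃ F ⊆ E, MeasurableSet F ∧ μ.real F = t := fun E hE t h0 h1 =>
    exists_subset_measureReal_eq
      (fun E hE hE0 ε hε => hap.exists_subset_measureReal_lt hTm hE hE0 hε) hE h0 h1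
  have hA : Nonempty A := by
    by_contra hA
    rw [not_nonempty_iff] at hA
    simp at hp
  obtain ⟨a⟩ := hA
  set τ : EuclideanSpace ℝ ((Fin l → A) × C) :=
    WithLp.toLp 2 fun d => (∏ i, p (d.1 i)) * μ.real (J ⁻¹' {d.2})
  let S : Set (EuclideanSpace ℝ ((Fin l → A) × C)) :=
    {z | ∃ f : X → A, Measurable f ∧ blockLaw μ T l J f - τ = z}
  obtain ⟨s, hsS, hspan⟩ := (Submodule.fg_span_iff_fg_span_finset_subset (R := ℝ) S).1
    (IsNoetherian.noetherian _)
  have hsS' : ∀ z : s, ∃ f : X → A, Measurable f ∧ blockLaw μ T l J f - τ = z := fun z => hsS z.2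
  choose g hgm hg using hsS'
  obtain ⟨h₀, hm₀, hN₀, hh₀⟩ := exists_clock hT hap (Nat.succ_pos l)
  -- The clock coordinate separates points of a segment; the other one makes every `g z` a
  -- substitution of the colour, so that the `v W` span all errors.
  let K := Fin (2 * (l + 1)) × (s → A)
  let c : X → K := fun x => (⟨h₀ x, hN₀ x⟩, fun z => g z x)
  have hc : Measurable c := by
    refine Measurable.prodMk ?_ (measurable_pi_lambda _ fun z => hgm z)
    refine measurable_to_countable' fun k => ?_
    have : (fun x => (⟨h₀ x, hN₀ x⟩ : Fin (2 * (l + 1)))) ⁻¹' {k} = h₀ ⁻¹' {(k : ℕ)} := by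
      ext x; simp [Fin.ext_iff]
    rw [this]
    exact hm₀ (measurableSet_singleton _)
  have hinj : ∀ᵐ x ∂μ, Function.Injective fun i : Fin l => c (T^[i] x) := by
    filter_upwards [ae_clock_injective hTm hh₀ (Nat.le_succ l)] with x hx i j hij
    exact hx (congrArg (fun z : K => (z.1 : ℕ)) hij)
  have hcW : ∀ W : K → A, Measurable fun x => W (c x) := fun W =>
    (measurable_of_countable W).comp hc
  let P : (K → A) → ℝ := fun W => ∏ k, p (W k)
  have hP0 : ∀ W, 0 < P W := fun W => Finset.prod_pos fun k _ => hp0 _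
  have hP1 : ∑ W, P W = 1 := by
    simpa using sum_prod_weight_mul_ite (K := K) hp (u := Fin.elim0) (fun i => i.elim0) Fin.elim0
  let v : (K → A) → EuclideanSpace ℝ ((Fin l → A) × C) := fun W =>
    blockLaw μ T l J (fun x => W (c x)) - τ
  have hv0 : ∑ W, P W • v W = 0 := by
    simp only [v, smul_sub, Finset.sum_sub_distrib]
    rw [← Finset.sum_smul, hP1, one_smul, sub_eq_zero]
    exact sum_weight_smul_blockLaw T.measurable hJ hc hinj hp
  have hS : S ⊆ Submodule.span ℝ (Set.range v) := by
    refine Submodule.subset_span.trans (hspan.le.trans ?_)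
    refine Submodule.span_mono fun z hz => ?_
    exact ⟨fun k => k.2 ⟨z, hz⟩, hg ⟨z, hz⟩⟩
  have : Nonempty (K → A) := ⟨fun _ => a⟩
  obtain ⟨ε, hε, hnear⟩ := exists_convex_combination_eq_zero_of_near v P hP0 hv0
  -- One factor `l` comes from the length of the block, the other from the `l` altered levels.
  set M : ℝ := Fintype.card ((Fin l → A) × C) * (l * l) with hM
  obtain ⟨N, hN⟩ := exists_nat_gt (M / ε)
  have hN' : M < ε * (N + l + 1 : ℕ) := by
    rw [div_lt_iff₀ hε] at hN
    push_cast
    nlinarith [Nat.cast_nonneg (α := ℝ) l]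
  obtain ⟨h, hm, hhN, hh⟩ := exists_clock hT hap (Nat.succ_pos (N + l))
  have hlt : MeasurableSet {x | h x < l} := measurableSet_lt hm measurable_const
  have hsmall := measureReal_clock_lt_le hTm hm hh (l := l) (by omega)
  let G : (K → A) → X → A := fun W x => if h x < l then a else W (c x)
  have hGm : ∀ W, Measurable (G W) := fun W => Measurable.ite hlt measurable_const (hcW W)
  obtain ⟨θ, hθ0, hθ1, hθ⟩ := hnear (fun W => blockLaw μ T l J (G W) - τ)
    (fun W => hS ⟨G W, hGm W, rfl⟩) fun W => by
      simp only [v, sub_sub_sub_cancel_right]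
      refine (norm_blockLaw_sub_le hTm hlt fun x hx => if_neg hx).trans_lt ?_
      have hNpos : (0 : ℝ) < (N + l + 1 : ℕ) := by positivity
      refine lt_of_mul_lt_mul_right (lt_of_le_of_lt ?_ hN') hNpos.le
      calc _ = (Fintype.card ((Fin l → A) × C) * l : ℝ) *
            ((N + l + 1 : ℕ) * μ.real {x | h x < l}) := by ring
        _ ≤ (Fintype.card ((Fin l → A) × C) * l : ℝ) * l := by
            gcongr
        _ = M := by rw [hM]; ring
  obtain ⟨f, hfm, hf⟩ := exists_blockLaw_eq_sum hTm H hJ hm hhN hh (l := l) (by omega) θ hθ0 hθ1 a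
    hcW
  refine ⟨f, hfm, ?_⟩
  simp only [smul_sub, Finset.sum_sub_distrib] at hθ
  rw [← Finset.sum_smul, hθ1, one_smul, sub_eq_zero] at hθ
  rw [hf, ← hθ]

end

/-! ### From vectors of probabilities to measures -/

theorem exists_block_map_eq_prod {X A C : Type*} [MeasurableSpace X] [Finite A]
    [MeasurableSpace A] [DiscreteMeasurableSpace A] [Finite C] [MeasurableSpace C]
    [DiscreteMeasurableSpace C] {μ : Measure X} [IsProbabilityMeasure μ] {T : X ≃ᵐ X}
    (hT : Ergodic T μ) (hap : IsAperiodic T μ) {J : X → C} (hJ : Measurable J) (l : ℕ)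
    (ν : Measure A) [IsProbabilityMeasure ν] :
    ∃ f : X → A, Measurable f ∧
      μ.map (fun x => ((fun i : Fin l => f (T^[i] x)), J x)) =
        (Measure.pi fun _ => ν).prod (μ.map J) := by
  classical
  have := Fintype.ofFinite A
  have := Fintype.ofFinite C
  -- Null letters are discarded because the perturbation argument needs strictly positive weights.
  let A' := {a : A // 0 < ν.real {a}}
  have hsum : ∑ a : A', ν.real {(a : A)} = 1 := by
    have h1 : ∑ a : A, ν.real {a} = 1 := by
      have := sum_measureReal_singleton (μ := ν) (Finset.univ : Finset A)
      rw [this]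
      simp
    rw [← h1, ← Finset.sum_subtype (Finset.univ.filter fun a => 0 < ν.real {a}) (by simp)
      fun a => ν.real {a}]
    refine Finset.sum_subset (Finset.subset_univ _) fun a _ ha => ?_
    have : ¬ 0 < ν.real {a} := by simpa using ha
    exact le_antisymm (not_lt.1 this) measureReal_nonneg
  obtain ⟨f, hfm, hf⟩ := exists_blockLaw_eq (A := A') hT hap hJ l (fun a => a.2) hsum
  have hfm' : Measurable fun x => (f x : A) := measurable_subtype_coe.comp hfm
  refine ⟨fun x => f x, hfm', ?_⟩
  have hb : Measurable fun x (i : Fin l) => (f (T^[i] x) : A) :=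
    measurable_pi_lambda _ fun i => hfm'.comp (T.measurable.iterate i)
  have hbJ : Measurable fun x => ((fun i : Fin l => (f (T^[i] x) : A)), J x) := hb.prodMk hJ
  have : IsProbabilityMeasure (μ.map J) := Measure.isProbabilityMeasure_map hJ.aemeasurable
  refine Measure.ext_of_singleton fun d => ?_
  rw [← Set.singleton_prod_singleton (a := d.1) (b := d.2), Measure.prod_prod,
    Measure.pi_singleton, Measure.map_apply hJ (MeasurableSet.of_discrete),
    Measure.map_apply hbJ (MeasurableSet.of_discrete)]
  have hset : (fun x => ((fun i : Fin l => (f (T^[i] x) : A)), J x)) ⁻¹' ({d.1} ×ˢ {d.2}) =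
      {x | (∀ i : Fin l, (f (T^[i] x) : A) = d.1 i) ∧ J x = d.2} := by
    ext x
    simp [Prod.ext_iff, funext_iff]
  rw [hset]
  by_cases hd : ∀ i, 0 < ν.real {d.1 i}
  · have h1 := congrArg (fun z => z ((fun i => (⟨d.1 i, hd i⟩ : A')), d.2)) hf
    rw [blockLaw_apply] at h1
    have h2 : {x | (∀ i : Fin l, f (T^[i] x) = (⟨d.1 i, hd i⟩ : A')) ∧ J x = d.2} =
        {x | (∀ i : Fin l, (f (T^[i] x) : A) = d.1 i) ∧ J x = d.2} := by
      ext x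
      exact and_congr_left fun _ => forall_congr' fun i => Subtype.ext_iff
    rw [h2] at h1
    rw [← ENNReal.toReal_eq_toReal_iff' (measure_ne_top _ _)
      (ENNReal.mul_ne_top (ENNReal.prod_ne_top fun i _ => measure_ne_top _ _)
        (measure_ne_top _ _)), ENNReal.toReal_mul, ENNReal.toReal_prod]
    exact h1
  · push Not at hd
    obtain ⟨i, hi⟩ := hd
    have h0 : ν {d.1 i} = 0 := by
      have := le_antisymm hi measureReal_nonneg
      exact (measureReal_eq_zero_iff (measure_ne_top _ _)).1 this
    rw [Finset.prod_eq_zero (Finset.mem_univ i) h0, zero_mul]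
    convert measure_empty (μ := μ)
    refine Set.eq_empty_of_forall_notMem ?_
    rintro x ⟨hx, -⟩
    have := (f (T^[i] x)).2
    rw [hx i] at this
    exact hi.not_gt this

theorem mainTheorem2
    -- an ergodic, aperiodic, invertible probability measure preserving system
    {X : Type*} [MeasurableSpace X] (μ : Measure X) [IsProbabilityMeasure μ]
    (T : X ≃ᵐ X) (hT : Ergodic T μ) (hTap : IsAperiodic T μ)
    -- a finite measurable partition (modulo null sets)
    {ι : Type*} [Finite ι] (ξ : ι → Set X) (hξm : ∀ j, MeasurableSet (ξ j))
    (hξd : Pairwise fun j k => μ (ξ j ∩ ξ k) = 0) (hξc : μ ((⋃ j, ξ j)ᶜ) = 0)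
    -- i.i.d. random variables with values in a finite set
    {A : Type*} [Finite A] [Nonempty A] [MeasurableSpace A] [DiscreteMeasurableSpace A]
    {Ω : Type*} [MeasurableSpace Ω] (P : Measure Ω) [IsProbabilityMeasure P]
    (l : ℕ) (Y : Fin l → Ω → A) (hYm : ∀ i, Measurable (Y i))
    (hYi : iIndepFun Y P) (hYd : ∀ i j, IdentDistrib (Y i) (Y j) P P) :
    ∃ f : X → A, Measurable f ∧
      IdentDistrib (fun x (i : Fin l) => f (T^[(i : ℕ)] x)) (fun ω (i : Fin l) => Y i ω) μ P ∧
      Indep (MeasurableSpace.comap (fun x (i : Fin l) => f (T^[(i : ℕ)] x)) inferInstance)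
        (MeasurableSpace.generateFrom (Set.range ξ)) μ := by

  obtain ⟨ν, hν, hY⟩ : ∃ ν : Measure A, IsProbabilityMeasure ν ∧ ∀ i, P.map (Y i) = ν := by
    rcases l with _ | l
    -- With no variables there is no common law to read off; any probability measure serves.
    · obtain ⟨a⟩ := ‹Nonempty A›
      exact ⟨Measure.dirac a, inferInstance, fun i => i.elim0⟩
    · exact ⟨P.map (Y 0), Measure.isProbabilityMeasure_map (hYm 0).aemeasurable,
        fun i => (hYd i 0).map_eq⟩
  -- The vector of memberships takes finitely many values and makes every `ξ j` measurable.
  let J : X → ι → Prop := fun x j => x ∈ ξ j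
  have hJ : Measurable J := measurable_pi_lambda _ fun j => measurableSet_setOfPred.1 (hξm j)
  obtain ⟨f, hf, hmap⟩ := exists_block_map_eq_prod hT hTap hJ l ν
  have hb : Measurable fun x (i : Fin l) => f (T^[i] x) :=
    measurable_pi_lambda _ fun i => hf.comp (T.measurable.iterate i)
  have : IsProbabilityMeasure (μ.map J) := Measure.isProbabilityMeasure_map hJ.aemeasurable
  have hlaw : μ.map (fun x (i : Fin l) => f (T^[i] x)) = Measure.pi fun _ => ν := by
    have h1 := congrArg (Measure.map Prod.fst) hmap
    rw [Measure.map_map measurable_fst (hb.prodMk hJ), Measure.map_fst_prod] at h1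
    simpa [Function.comp_def] using h1
  refine ⟨f, hf, ⟨hb.aemeasurable, (measurable_pi_lambda _ hYm).aemeasurable, ?_⟩, ?_⟩
  · rw [hlaw, (iIndepFun_iff_map_fun_eq_pi_map fun i => (hYm i).aemeasurable).1 hYi]
    simp only [hY]
  · have hind : IndepFun (fun x (i : Fin l) => f (T^[i] x)) J μ := by
      rw [indepFun_iff_map_prod_eq_prod_map_map hb.aemeasurable hJ.aemeasurable, hlaw, hmap]
    refine indep_of_indep_of_le_right hind (MeasurableSpace.generateFrom_le ?_)
    rintro _ ⟨j, rfl⟩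
    exact ⟨{e | e j}, MeasurableSet.of_discrete, rfl⟩
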